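/- Theorem 2. There exist a countable set $X$ (with the discrete $\sigma$-algebra), a Markov transition kernel $P$ on $X$ and a probability measure $\pi$ on $X$ that is invariant for $P$ such that the following hold. (a) The chain is $\psi$-irreducible and aperiodic: there is a nonzero $\sigma$-finite measure $\psi$ on $X$ such that for every $A\subseteq X$ with $\psi(A)>0$ and every $x\in X$ one has $P^n(x,A)>0$ for all sufficiently large $n$, and $\psi$ is maximal, in the sense that every other $\sigma$-finite measure with this property is absolutely continuous with respect to $\psi$. (b) The chain is geometrically ergodic: there are functions $\rho:X\to(0,1)$ and $C:X\to[1,\infty)$ such that, for $\pi$-almost every $x$, $$\sup_{A\subseteq X}|P^n(x,A)-\pi(A)|\le C(x)\,\rho(x)^n\qquad\text{for all } n\ge 0 .$$ (c) $P$ does not admit a spectral gap in $L_2(\pi)$. That is, let $P$ act on the complex Hilbert space $L_2(\pi)$ by $PF(x)=\int F(y)\,P(x,dy)$, and let $\mathcal S_2$ be the set of nonzero $\lambda\in\mathbb C$ for which $\lambda I-P$ has no bounded inverse on $L_2(\pi)$. Then there is no $\varepsilon_0>0$ such that $\mathcal S_2\cap\{z:|z|\ge 1-\varepsilon_0\}$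 is finite and consists only of poles of finite multiplicity, that is, of isolated points of the spectrum whose spectral projection $\frac1{2\pi i}\oint (zI-P)^{-1}dz$ (over a small circle around the point) has finite rank. (d) There is a function $G:X\to\mathbb R$ in $L_2(\pi)$ with $\int G\,d\pi=0$ such that, for the stationary chain $(X(i))_{i\ge0}$ with transition kernel $P$ and $X(0)\sim\pi$, the distributions of the normalized sums $$\frac1{\sqrt n}\sum_{i=0}^{n-1}G(X(i)),\qquad n\ge 1,$$ do not form a tight family of probability measures on $\mathbb R$. -/

import Mathlib

open MeasureTheory ProbabilityTheory
open scoped ENNReal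

noncomputable section

namespace MarkovGap

section Kernel

variable {X : Type*} [MeasurableSpace X]

/-- `ψ` is a `σ`-finite measure such that every measurable set of positive `ψ`-measure has, from
every initial state, positive probability under `P ^ n` for all sufficiently large `n`. -/
def IsAperiodicIrreducibilityMeasure (P : Kernel X X) (ψ : Measure X) : Prop :=
  SigmaFinite ψ ∧ ∀ A : Set X, MeasurableSet A → 0 < ψ A →
    ∀ x : X, ∃ N : ℕ, ∀ n : ℕ, N ≤ n → 0 < (P ^ n) x A

/-- The chain with transition kernel `P` is `ψ`-irreducible and aperiodic: there is a nontrivial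
measure `ψ` as above which is maximal, that is, any other one is absolutely continuous with
respect to `ψ`. -/
def IsPsiIrreducibleAperiodic (P : Kernel X X) : Prop :=
  ∃ ψ : Measure X, ψ ≠ 0 ∧ IsAperiodicIrreducibilityMeasure P ψ ∧
    ∀ ψ' : Measure X, IsAperiodicIrreducibilityMeasure P ψ' → ψ' ≪ ψ

/-- Total variation distance `sup_A |μ A - ν A|` of two finite measures. -/
def tvDist (μ ν : Measure X) : ℝ≥0∞ :=
  ⨆ (A : Set X) (_ : MeasurableSet A), ENNReal.ofReal |μ.real A - ν.real A|

/-- The chain with transition kernel `P` is geometrically ergodic, with invariant probability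
measure `π`: for functions `ρ : X → (0, 1)` and `C : X → [1, ∞)`, one has
`‖P ^ n (x, ·) - π‖_TV ≤ C x * ρ x ^ n` for all `n ≥ 0`, for `π`-almost every `x`. -/
def IsGeometricallyErgodic (P : Kernel X X) (π : Measure X) : Prop :=
  IsProbabilityMeasure π ∧ P.Invariant π ∧
    ∃ ρ C : X → ℝ, (∀ x, 0 < ρ x ∧ ρ x < 1) ∧ (∀ x, 1 ≤ C x) ∧
      ∀ᵐ x ∂π, ∀ n : ℕ, tvDist ((P ^ n) x) π ≤ ENNReal.ofReal (C x * ρ x ^ n)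

/-- The law on the path space of the stationary Markov chain `(X 0, X 1, …)` with transition
kernel `P` and initial distribution `π`. -/
def pathLaw (P : Kernel X X) [IsMarkovKernel P] (π : Measure X) : Measure (ℕ → X) :=
  Kernel.trajMeasure (X := fun _ => X) π fun n =>
    P.comap (fun w : (i : Finset.Iic n) → X => w ⟨n, Finset.mem_Iic.2 le_rfl⟩)
      (measurable_pi_apply _)

/-- The normalized partial sum `n ^ (-1/2) * ∑_{i < n} G (X i)`. -/
def normalizedSum (G : X → ℝ) (n : ℕ) (w : ℕ → X) : ℝ :=
  (∑ i ∈ Finset.range n, G (w i)) / Real.sqrt n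

end Kernel

section L2

variable {X : Type*} [MeasurableSpace X] {P : Kernel X X} {π : Measure X}

theorem integral_kernel_congr_ae (hπ : P.Invariant π) {F G : X → ℂ} (h : F =ᵐ[π] G) :
    (fun x => ∫ y, F y ∂P x) =ᵐ[π] fun x => ∫ y, G y ∂P x := by
  have hb : π.bind P = π := hπ
  have h' : F =ᵐ[π.bind P] G := by rwa [hb]
  filter_upwards [Measure.ae_ae_of_ae_comp h'] with x hx
  exact integral_congr_ae hx

theorem ae_integrable_kernel [IsFiniteMeasure π] (hπ : P.Invariant π) (F : Lp ℂ 2 π) :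
    ∀ᵐ x ∂π, Integrable F (P x) := by
  have hb : π.bind P = π := hπ
  have h : Integrable F (π.bind P) := by
    rw [hb]; exact (Lp.memLp F).integrable (by norm_num)
  exact Measure.ae_integrable_of_integrable_comp h

variable [IsMarkovKernel P]

theorem eLpNorm_integral_kernel_le (hπ : P.Invariant π) {F : X → ℂ}
    (hF : AEStronglyMeasurable F π) :
    eLpNorm (fun x => ∫ y, F y ∂P x) 2 π ≤ eLpNorm F 2 π := by
  have hb : π.bind P = π := hπ
  have hF' : AEStronglyMeasurable F (π.bind P) := by rwa [hb]
  have h1 : ∀ᵐ x ∂π, AEStronglyMeasurable F (P x) := by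
    filter_upwards [Measure.ae_ae_of_ae_comp hF'.ae_eq_mk] with x hx
    exact ⟨hF'.mk F, hF'.stronglyMeasurable_mk, hx⟩
  have h2 : ∀ᵐ x ∂π, ‖∫ y, F y ∂P x‖ₑ ^ (2 : ℝ) ≤ ∫⁻ y, ‖F y‖ₑ ^ (2 : ℝ) ∂P x := by
    filter_upwards [h1] with x hx
    have h3 : ‖∫ y, F y ∂P x‖ₑ ≤ eLpNorm F 2 (P x) :=
      calc ‖∫ y, F y ∂P x‖ₑ ≤ ∫⁻ y, ‖F y‖ₑ ∂P x := enorm_integral_le_lintegral_enorm _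
        _ = eLpNorm F 1 (P x) := eLpNorm_one_eq_lintegral_enorm.symm
        _ ≤ eLpNorm F 2 (P x) := eLpNorm_le_eLpNorm_of_exponent_le (by norm_num) hx
    calc ‖∫ y, F y ∂P x‖ₑ ^ (2 : ℝ) ≤ (eLpNorm F 2 (P x)) ^ (2 : ℝ) := by gcongr
      _ = ∫⁻ y, ‖F y‖ₑ ^ (2 : ℝ) ∂P x := by
        rw [eLpNorm_eq_lintegral_rpow_enorm_toReal (by norm_num) (by norm_num)]
        rw [← ENNReal.rpow_mul]
        norm_num
  rw [eLpNorm_eq_lintegral_rpow_enorm_toReal (by norm_num) (by norm_num),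
    eLpNorm_eq_lintegral_rpow_enorm_toReal (by norm_num) (by norm_num)]
  simp only [ENNReal.toReal_ofNat]
  gcongr ?_ ^ _
  calc ∫⁻ x, ‖∫ y, F y ∂P x‖ₑ ^ (2 : ℝ) ∂π
      ≤ ∫⁻ x, ∫⁻ y, ‖F y‖ₑ ^ (2 : ℝ) ∂P x ∂π := lintegral_mono_ae h2
    _ = ∫⁻ y, ‖F y‖ₑ ^ (2 : ℝ) ∂(π.bind P) :=
        (Measure.lintegral_bind P.aemeasurable (hF'.enorm.pow_const _)).symm
    _ = ∫⁻ y, ‖F y‖ₑ ^ (2 : ℝ) ∂π := by rw [hb]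

theorem memLp_integral_kernel (hπ : P.Invariant π) {F : X → ℂ} (hF : MemLp F 2 π) :
    MemLp (fun x => ∫ y, F y ∂P x) 2 π := by
  have hb : π.bind P = π := hπ
  refine ⟨?_, (eLpNorm_integral_kernel_le hπ hF.1).trans_lt hF.2⟩
  have hF' : AEStronglyMeasurable F (π.bind P) := by rw [hb]; exact hF.1
  refine ⟨fun x => ∫ y, hF'.mk F y ∂P x, hF'.stronglyMeasurable_mk.integral_kernel, ?_⟩
  filter_upwards [Measure.ae_ae_of_ae_comp hF'.ae_eq_mk] with x hx
  exact integral_congr_ae hx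

/-- The transition kernel `P`, with invariant finite measure `π`, as a bounded linear operator
on the complex Hilbert space `L₂(π)`, acting by `(P F)(x) = ∫ F(y) P(x, dy)`. -/
def l2Operator (P : Kernel X X) [IsMarkovKernel P] (π : Measure X) [IsFiniteMeasure π]
    (hπ : P.Invariant π) : Lp ℂ 2 π →L[ℂ] Lp ℂ 2 π :=
  LinearMap.mkContinuous
    { toFun := fun F => (memLp_integral_kernel hπ (Lp.memLp F)).toLp
      map_add' := fun F G => by
        rw [← MemLp.toLp_add]
        refine MemLp.toLp_congr _ _ ?_
        filter_upwards [integral_kernel_congr_ae hπ (Lp.coeFn_add F G),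
          ae_integrable_kernel hπ F, ae_integrable_kernel hπ G] with x hx h1 h2
        rw [hx]
        exact integral_add h1 h2
      map_smul' := fun c F => by
        rw [RingHom.id_apply, ← MemLp.toLp_const_smul]
        refine MemLp.toLp_congr _ _ ?_
        filter_upwards [integral_kernel_congr_ae hπ (Lp.coeFn_smul c F)] with x hx
        rw [hx]
        exact integral_smul c _ }
    1 (fun F => by
      rw [one_mul]
      change ‖(memLp_integral_kernel hπ (Lp.memLp F)).toLp‖ ≤ ‖F‖
      rw [Lp.norm_toLp, Lp.norm_def]
      exact ENNReal.toReal_mono (Lp.eLpNorm_ne_top F)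
        (eLpNorm_integral_kernel_le hπ (Lp.aestronglyMeasurable F)))

theorem l2Operator_ae_eq [IsFiniteMeasure π] (hπ : P.Invariant π) (F : Lp ℂ 2 π) :
    l2Operator P π hπ F =ᵐ[π] fun x => ∫ y, F y ∂P x :=
  MemLp.coeFn_toLp (memLp_integral_kernel hπ (Lp.memLp F))

end L2

section Spectrum

variable {E : Type*} [NormedAddCommGroup E] [NormedSpace ℂ E]

/-- The set of nonzero `z` for which `(z I - T)⁻¹` does not exist as a bounded operator. -/
def nonzeroSpectrum (T : E →L[ℂ] E) : Set ℂ :=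
  {z | z ≠ 0 ∧ z ∈ spectrum ℂ T}

/-- `z₀` is a pole of finite multiplicity of `T`: it is an isolated point of the spectrum, and the
spectral projection `(2πi)⁻¹ ∮ (z I - T)⁻¹ dz` over a small circle around `z₀`, which encloses and
meets no other point of the spectrum, has finite rank. -/
def IsPoleOfFiniteMultiplicity (T : E →L[ℂ] E) (z₀ : ℂ) : Prop :=
  z₀ ∈ spectrum ℂ T ∧ ∃ r : ℝ, 0 < r ∧
    (∀ z ∈ spectrum ℂ T, z ∈ Metric.closedBall z₀ r → z = z₀) ∧
    FiniteDimensional ℂ (LinearMap.range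
      ((2 * (Real.pi : ℂ) * Complex.I)⁻¹ • ∮ z in C(z₀, r), resolvent T z).toLinearMap)

/-- `T` admits a spectral gap: for some `ε > 0`, the part of the nonzero spectrum in `|z| ≥ 1 - ε`
is finite and consists of poles of finite multiplicity. -/
def HasSpectralGap (T : E →L[ℂ] E) : Prop :=
  ∃ ε : ℝ, 0 < ε ∧ (nonzeroSpectrum T ∩ {z : ℂ | 1 - ε ≤ ‖z‖}).Finite ∧
    ∀ z ∈ nonzeroSpectrum T ∩ {z : ℂ | 1 - ε ≤ ‖z‖}, IsPoleOfFiniteMultiplicity T z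

end Spectrum

end MarkovGap

end

/-
The chain runs through independent blocks of geometric length, each carrying an independent fair
sign. The residual length is memoryless, so at each step two chains whose residual lengths and signs
are fresh, but whose ages differ, merge with probability `1 / 2`. This gives (a) and (b).

For `|z| = 1` consider the function `z ^ age · sign` on the blocks of length `m + 1`. The sign makes
its mean over a fresh block vanish, so `P` multiplies it by `z` except at the last state of a block,
a proportion `1 / (m + 1)` of its support. Hence the whole unit circle lies in the spectrum.

If the normalized sums were tight for every centred `G` in `L₂(π)`, then Baire's theorem would make
the bound uniform: `S_n(G) / √n` would exceed `C ‖G‖` only with small probability, for all `n` and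
`G` at once. The functions `sign` on the blocks of length `m + 1` contradict this: their norm is
about `√(m / 2 ^ m)`, while in time `2 ^ m` the path meets exactly one such block with probability
bounded below, and then the sum is `± (m + 1)`.
-/

open Filter
open scoped Topology

noncomputable section

namespace MarkovGap

theorem abs_measureReal_sub_measureReal_le_one {Ω : Type*} [MeasurableSpace Ω] {μ ν : Measure Ω}
    [IsProbabilityMeasure μ] [IsProbabilityMeasure ν] (A : Set Ω) :
    |μ.real A - ν.real A| ≤ 1 :=
  abs_sub_le_of_nonneg_of_le measureReal_nonneg measureReal_le_one measureReal_nonneg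
    measureReal_le_one

theorem sum_sub_sum_inter_le_measureReal_existsUnique {Ω ι : Type*} [DecidableEq ι]
    [MeasurableSpace Ω] {Q : Measure Ω} [IsFiniteMeasure Q] (s : Finset ι) {A : ι → Set Ω}
    (hA : ∀ i, MeasurableSet (A i)) :
    ∑ i ∈ s, (Q.real (A i) - ∑ j ∈ s.erase i, Q.real (A i ∩ A j))
      ≤ Q.real {ω | ∃! i, i ∈ s ∧ ω ∈ A i} := by
  let B (i : ι) : Set Ω := A i \ ⋃ j ∈ s.erase i, A j
  have hB : ∀ i, MeasurableSet (B i) := fun i =>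
    (hA i).diff (Finset.measurableSet_biUnion _ fun j _ => hA j)
  have hdisj : (s : Set ι).PairwiseDisjoint B := fun i hi j _ hij =>
    Set.disjoint_left.2 fun ω hωi hωj =>
      hωj.2 (Set.mem_biUnion (Finset.mem_erase.2 ⟨hij, hi⟩) hωi.1)
  have hunique : ⋃ i ∈ s, B i ⊆ {ω | ∃! i, i ∈ s ∧ ω ∈ A i} := by
    refine Set.iUnion₂_subset fun i hi ω hω => ⟨i, ⟨hi, hω.1⟩, fun j hj => ?_⟩
    by_contra hji
    exact hω.2 (Set.mem_biUnion (Finset.mem_erase.2 ⟨hji, hj.1⟩) hj.2)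
  have hle : ∀ i, Q.real (A i) - ∑ j ∈ s.erase i, Q.real (A i ∩ A j) ≤ Q.real (B i) := fun i => by
    have hinter : Q.real (A i ∩ ⋃ j ∈ s.erase i, A j) ≤ ∑ j ∈ s.erase i, Q.real (A i ∩ A j) := by
      simp only [Set.inter_iUnion₂]
      exact measureReal_biUnion_finset_le _ _
    have hsplit := measureReal_sdiff_add_inter (μ := Q) (s := A i)
      (Finset.measurableSet_biUnion (s.erase i) fun j _ => hA j)
    linarith
  calc ∑ i ∈ s, (Q.real (A i) - ∑ j ∈ s.erase i, Q.real (A i ∩ A j))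
      ≤ ∑ i ∈ s, Q.real (B i) := Finset.sum_le_sum fun i _ => hle i
    _ = Q.real (⋃ i ∈ s, B i) := (measureReal_biUnion_finset hdisj fun i _ => hB i).symm
    _ ≤ _ := measureReal_mono hunique

theorem memLp_of_norm_eq_indicator {X E : Type*} [MeasurableSpace X] [NormedAddCommGroup E]
    {μ : Measure X} [IsFiniteMeasure μ] {p : ℝ≥0∞} {A : Set X} {f : X → E}
    (hmeas : AEStronglyMeasurable f μ) (hf : ∀ x, ‖f x‖ = A.indicator 1 x) : MemLp f p μ :=
  .of_bound hmeas 1 (.of_forall fun x => (hf x).trans_le (Set.indicator_le_self' (by simp) x))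

theorem toReal_eLpNorm_two_of_norm_eq_indicator {X E : Type*} [MeasurableSpace X]
    [NormedAddCommGroup E] {μ : Measure X} {A : Set X} (hA : MeasurableSet A) {f : X → E}
    (hf : ∀ x, ‖f x‖ = A.indicator 1 x) : (eLpNorm f 2 μ).toReal = √(μ.real A) := by
  have hnorm : eLpNorm f 2 μ = eLpNorm (A.indicator fun _ => (1 : ℝ)) 2 μ :=
    eLpNorm_congr_norm_ae (.of_forall fun x => by
      rw [hf, Real.norm_of_nonneg (Set.indicator_nonneg (by simp) x)]; rfl)
  rw [hnorm, eLpNorm_indicator_const hA two_ne_zero ENNReal.ofNat_ne_top, enorm_one, one_mul,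
    ENNReal.toReal_ofNat, ← ENNReal.toReal_rpow, Real.sqrt_eq_rpow]
  rfl

section Convergence

variable {X : Type*} [MeasurableSpace X] {P : Kernel X X} {π : Measure X}

instance isMarkovKernel_pow [IsMarkovKernel P] (n : ℕ) : IsMarkovKernel (P ^ n) := by
  induction n with
  | zero => rw [pow_zero]; exact inferInstanceAs (IsMarkovKernel Kernel.id)
  | succ n ih => rw [pow_succ]; exact inferInstanceAs (IsMarkovKernel ((P ^ n) ∘ₖ P))

theorem invariant_pow (hπ : P.Invariant π) (n : ℕ) : (P ^ n).Invariant π := by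
  induction n with
  | zero => rw [pow_zero]; exact Measure.id_comp
  | succ n ih => rw [pow_succ]; exact ih.comp hπ

theorem isGeometricallyErgodic_of_abs_sub_le [IsProbabilityMeasure π] (hπ : P.Invariant π)
    {ρ : ℝ} {C : X → ℝ} (hρ₀ : 0 < ρ) (hρ₁ : ρ < 1) (hC : ∀ x, 1 ≤ C x)
    (h : ∀ x n A, MeasurableSet A → |((P ^ n) x).real A - π.real A| ≤ C x * ρ ^ n) :
    IsGeometricallyErgodic P π :=
  ⟨inferInstance, hπ, fun _ => ρ, C, fun _ => ⟨hρ₀, hρ₁⟩, hC, .of_forall fun x n =>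
    iSup₂_le fun A hA => ENNReal.ofReal_le_ofReal (h x n A hA)⟩

/-- Pointwise convergence alone makes `π` an irreducibility measure; it is maximal because a
`π`-null set is, by invariance, never visited from `π`-almost every starting point. -/
theorem isPsiIrreducibleAperiodic_of_tendsto [IsMarkovKernel P] [IsProbabilityMeasure π]
    (hπ : P.Invariant π)
    (h : ∀ x A, MeasurableSet A →
      Tendsto (fun n => ((P ^ n) x).real A) atTop (𝓝 (π.real A))) :
    IsPsiIrreducibleAperiodic P := by
  refine ⟨π, IsProbabilityMeasure.ne_zero π, ⟨inferInstance, fun A hA hπA x => ?_⟩,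
    fun ψ hψ => Measure.AbsolutelyContinuous.mk fun A hA hπA => ?_⟩
  · have hpos : 0 < π.real A := ENNReal.toReal_pos hπA.ne' (measure_ne_top π A)
    obtain ⟨N, hN⟩ := eventually_atTop.1 ((h x A hA).eventually_const_lt hpos)
    exact ⟨N, fun n hn => (ENNReal.toReal_pos_iff.1 (hN n hn)).1⟩
  · have hnull : ∀ n, ∀ᵐ x ∂π, (P ^ n) x A = 0 := fun n => by
      have hA' : ∀ᵐ y ∂π.bind (P ^ n), y ∉ A := by
        rwa [(invariant_pow hπ n).def, ← measure_eq_zero_iff_ae_notMem]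
      exact (Measure.ae_ae_of_ae_comp hA').mono fun x hx => measure_eq_zero_iff_ae_notMem.2 hx
    obtain ⟨x, hx⟩ := (ae_all_iff.2 hnull).exists
    by_contra hψA
    obtain ⟨N, hN⟩ := hψ.2 A hA (pos_iff_ne_zero.2 hψA) x
    exact (hN N le_rfl).ne' (hx N)

end Convergence

section Spectrum

theorem mem_spectrum_of_forall_exists_lt_norm {E : Type*} [NormedAddCommGroup E] [NormedSpace ℂ E]
    {T : E →L[ℂ] E} {z : ℂ} (h : ∀ C : ℝ, ∃ x, C * ‖z • x - T x‖ < ‖x‖) : z ∈ spectrum ℂ T := by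
  rw [spectrum.mem_iff]
  rintro ⟨u, hu⟩
  obtain ⟨x, hx⟩ := h ‖(↑u⁻¹ : E →L[ℂ] E)‖
  have hinv : (↑u⁻¹ : E →L[ℂ] E) (z • x - T x) = x := by
    have hval : (u : E →L[ℂ] E) x = z • x - T x := by
      rw [hu]; simp [Algebra.algebraMap_eq_smul_one]
    rw [← hval, ← mul_apply_eq_comp, Units.inv_mul, one_apply_eq_self]
  exact hx.not_ge (by simpa only [hinv] using (↑u⁻¹ : E →L[ℂ] E).le_opNorm (z • x - T x))

theorem infinite_sphere_zero_one : (Metric.sphere (0 : ℂ) 1).Infinite :=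
  (isPreconnected_sphere (by simp [Complex.rank_real_complex]) 0 1).infinite_of_nontrivial
    ⟨1, by simp, -1, by simp, by norm_num⟩

theorem not_hasSpectralGap_of_sphere_subset_spectrum {E : Type*} [NormedAddCommGroup E]
    [NormedSpace ℂ E] {T : E →L[ℂ] E} (h : Metric.sphere (0 : ℂ) 1 ⊆ spectrum ℂ T) :
    ¬ HasSpectralGap T := by
  rintro ⟨ε, hε, hfin, -⟩
  refine infinite_sphere_zero_one (hfin.subset fun z hz => ⟨⟨?_, h hz⟩, ?_⟩)
  · exact ne_zero_of_mem_unit_sphere ⟨z, hz⟩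
  · rw [Set.mem_ofPred_eq, mem_sphere_zero_iff_norm.1 hz]
    linarith

variable {X : Type*} [MeasurableSpace X] {P : Kernel X X} [IsMarkovKernel P] {π : Measure X}
  [IsFiniteMeasure π]

theorem norm_smul_toLp_sub_l2Operator (hπ : P.Invariant π) {F : X → ℂ} (hF : MemLp F 2 π) (z : ℂ) :
    ‖z • hF.toLp - l2Operator P π hπ hF.toLp‖
      = (eLpNorm (fun x => z * F x - ∫ y, F y ∂P x) 2 π).toReal := by
  rw [Lp.norm_def]
  congr 1
  refine eLpNorm_congr_ae ?_
  filter_upwards [Lp.coeFn_sub (z • hF.toLp) (l2Operator P π hπ hF.toLp),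
    Lp.coeFn_smul z hF.toLp, hF.coeFn_toLp, l2Operator_ae_eq hπ hF.toLp,
    integral_kernel_congr_ae hπ hF.coeFn_toLp] with x hsub hsmul hval hop hcongr
  rw [hsub, Pi.sub_apply, hsmul, Pi.smul_apply, hval, hop, hcongr, smul_eq_mul]

theorem mem_spectrum_l2Operator (hπ : P.Invariant π) {z : ℂ}
    (h : ∀ C : ℝ, ∃ F : X → ℂ, MemLp F 2 π ∧
      C * (eLpNorm (fun x => z * F x - ∫ y, F y ∂P x) 2 π).toReal < (eLpNorm F 2 π).toReal) :
    z ∈ spectrum ℂ (l2Operator P π hπ) := by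
  refine mem_spectrum_of_forall_exists_lt_norm fun C => ?_
  obtain ⟨F, hF, hlt⟩ := h C
  exact ⟨hF.toLp, by rwa [norm_smul_toLp_sub_l2Operator, Lp.norm_toLp]⟩

end Spectrum

section PathLaw

variable {X : Type*} [MeasurableSpace X] {P : Kernel X X} [IsMarkovKernel P] {π : Measure X}

instance [IsProbabilityMeasure π] : IsProbabilityMeasure (pathLaw P π) := by
  unfold pathLaw; infer_instance

theorem pathLaw_map_zero : (pathLaw P π).map (fun w => w 0) = π := by
  have h : (fun w : ℕ → X => w 0) = (fun v : (i : Finset.Iic 0) → X => v ⟨0, by simp⟩) ∘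
      Preorder.frestrictLe (π := fun _ => X) 0 := rfl
  rw [h, ← Measure.map_map (by fun_prop) (by fun_prop), pathLaw, Kernel.trajMeasure,
    Measure.map_comp _ _ (by fun_prop), Kernel.traj_map_frestrictLe, Kernel.partialTraj_self,
    Measure.id_comp, Measure.map_map (by fun_prop) (by fun_prop)]
  exact Measure.map_id

variable [IsProbabilityMeasure π]

theorem pathLaw_step_apply (n : ℕ) {D : Set (((i : Finset.Iic n) → X) × X)}
    (hD : MeasurableSet D) :
    pathLaw P π {w | (Preorder.frestrictLe (π := fun _ => X) n w, w (n + 1)) ∈ D}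
      = ∫⁻ w, P (w n) {y | (Preorder.frestrictLe (π := fun _ => X) n w, y) ∈ D} ∂pathLaw P π := by
  have h := Kernel.map_frestrictLe_trajMeasure_compProd_eq_map_trajMeasure
    (X := fun _ => X) (μ₀ := π) (κ := fun n => P.comap
      (fun w : (i : Finset.Iic n) → X => w ⟨n, Finset.mem_Iic.2 le_rfl⟩)
      (measurable_pi_apply _)) (a := n)
  change (pathLaw P π).map _ ⊗ₘ _ = (pathLaw P π).map _ at h
  have hD' := DFunLike.congr_fun h D
  rw [Measure.map_apply (by fun_prop) hD, Measure.compProd_apply hD,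
    lintegral_map (Kernel.measurable_kernel_prodMk_left hD) (by fun_prop)] at hD'
  exact hD'.symm

theorem measurePreserving_eval_pathLaw (hπ : P.Invariant π) (n : ℕ) :
    MeasurePreserving (fun w : ℕ → X => w n) (pathLaw P π) π := by
  refine ⟨measurable_pi_apply n, ?_⟩
  induction n with
  | zero => exact pathLaw_map_zero
  | succ n ih =>
    ext B hB
    rw [Measure.map_apply (by fun_prop) hB]
    calc pathLaw P π {w | w (n + 1) ∈ B}
        = ∫⁻ w, P (w n) B ∂pathLaw P π := pathLaw_step_apply n (measurable_snd hB)
      _ = ∫⁻ x, P x B ∂π := by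
          rw [← ih, lintegral_map (P.measurable_coe hB) (measurable_pi_apply n), ih]
      _ = π B := by rw [← Measure.bind_apply hB P.aemeasurable, hπ.def]

theorem pathLaw_real_eval (hπ : P.Invariant π) (n : ℕ) {A : Set X} (hA : MeasurableSet A) :
    (pathLaw P π).real {w | w n ∈ A} = π.real A :=
  (measurePreserving_eval_pathLaw hπ n).measureReal_preimage hA.nullMeasurableSet

theorem ae_pathLaw_step {R : X → X → Prop} (hR : MeasurableSet {p : X × X | R p.1 p.2})
    (h : ∀ x, ∀ᵐ y ∂P x, R x y) : ∀ᵐ w ∂pathLaw P π, ∀ n, R (w n) (w (n + 1)) := by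
  refine ae_all_iff.2 fun n => ?_
  have hstep := pathLaw_step_apply (P := P) (π := π) n
    (D := {p | ¬ R (p.1 ⟨n, Finset.mem_Iic.2 le_rfl⟩) p.2})
    (hR.preimage (f := fun p : ((i : Finset.Iic n) → X) × X =>
      (p.1 ⟨n, Finset.mem_Iic.2 le_rfl⟩, p.2)) (by fun_prop)).compl
  exact ae_iff.2 (hstep.trans (lintegral_eq_zero_of_ae_eq_zero (.of_forall fun w => h (w n))))

theorem pathLaw_pair_le (hπ : P.Invariant π) {A B : Set X} (hA : MeasurableSet A)
    (hB : MeasurableSet B) {p : ℝ≥0∞} (hp : ∀ x, P x B ≤ p) {i j : ℕ} (hij : i < j) :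
    pathLaw P π {w | w i ∈ A ∧ w j ∈ B} ≤ p * π A := by
  obtain ⟨n, rfl⟩ : ∃ n, j = n + 1 := ⟨j - 1, by omega⟩
  calc pathLaw P π {w | w i ∈ A ∧ w (n + 1) ∈ B}
      = ∫⁻ w, P (w n) {y | w i ∈ A ∧ y ∈ B} ∂pathLaw P π :=
        pathLaw_step_apply n (D := {v | v.1 ⟨i, Finset.mem_Iic.2 (by omega)⟩ ∈ A ∧ v.2 ∈ B})
          ((hA.preimage (by fun_prop)).inter (hB.preimage (by fun_prop)))
    _ ≤ ∫⁻ w, {w | w i ∈ A}.indicator (fun _ => p) w ∂pathLaw P π := by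
        refine lintegral_mono fun w => ?_
        by_cases hw : w i ∈ A
        · simpa [hw] using hp (w n)
        · simp [hw]
    _ = p * pathLaw P π {w | w i ∈ A} :=
        lintegral_indicator_const (hA.preimage (measurable_pi_apply i)) _
    _ = p * π A := by
        rw [← (measurePreserving_eval_pathLaw hπ i).measure_preimage hA.nullMeasurableSet]
        rfl

end PathLaw

section UniformBoundedness

variable {Ω E F ι : Type*} [MeasurableSpace Ω] [NormedAddCommGroup F] {Q : Measure Ω} {p : ℝ≥0∞}

theorem measure_add_lt_norm_sub_le (f g : Lp F p Q) (r s : ℝ) :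
    Q {ω | r + s < ‖(f - g) ω‖} ≤ Q {ω | r < ‖f ω‖} + Q {ω | s < ‖g ω‖} := by
  refine (measure_mono_ae ?_).trans (measure_union_le _ _)
  filter_upwards [Lp.coeFn_sub f g] with ω hω (hlt : r + s < ‖(f - g) ω‖)
  rw [hω, Pi.sub_apply] at hlt
  exact lt_or_lt_of_add_lt_add (hlt.trans_le (norm_sub_le _ _))

theorem measure_lt_norm_smul [NormedSpace ℝ F] (f : Lp F p Q) {a : ℝ} (ha : 0 < a) (r : ℝ) :
    Q {ω | a * r < ‖(a • f) ω‖} = Q {ω | r < ‖f ω‖} := by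
  refine measure_congr ?_
  filter_upwards [Lp.coeFn_smul a f] with ω hω
  change (a * r < ‖(a • f) ω‖) = (r < ‖f ω‖)
  rw [hω, Pi.smul_apply, norm_smul, Real.norm_of_nonneg ha.le, mul_lt_mul_iff_right₀ ha]

variable [Fact (1 ≤ p)]

theorem isClosed_setOf_measure_lt_norm_le (r : ℝ) (ε : ℝ≥0∞) :
    IsClosed {f : Lp F p Q | Q {ω | r < ‖f ω‖} ≤ ε} := by
  refine IsSeqClosed.isClosed fun f g hf hfg => ?_
  obtain ⟨φ, -, hφ⟩ := (tendstoInMeasure_of_tendsto_Lp hfg).exists_seq_tendsto_ae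
  have hmeas : ∀ h : Lp F p Q, MeasurableSet {ω | r < ‖h ω‖} := fun h =>
    measurableSet_lt measurable_const (Lp.stronglyMeasurable h).norm.measurable
  calc Q {ω | r < ‖g ω‖}
      = ∫⁻ ω, {ω | r < ‖g ω‖}.indicator 1 ω ∂Q := (lintegral_indicator_one (hmeas g)).symm
    _ ≤ ∫⁻ ω, liminf (fun k => {ω | r < ‖f (φ k) ω‖}.indicator 1 ω) atTop ∂Q := by
        refine lintegral_mono_ae ?_
        filter_upwards [hφ] with ω hω
        refine Set.indicator_apply_le' (fun hlt => ?_) fun _ => zero_le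
        refine le_liminf_of_le (by isBoundedDefault) ?_
        filter_upwards [hω.norm.eventually_const_lt hlt] with k hk
        exact (Set.indicator_of_mem (show ω ∈ {ω | r < ‖f (φ k) ω‖} from hk) 1).ge
    _ ≤ liminf (fun k => ∫⁻ ω, {ω | r < ‖f (φ k) ω‖}.indicator 1 ω ∂Q) atTop :=
        lintegral_liminf_le fun k => measurable_one.indicator (hmeas _)
    _ ≤ ε := by
        refine liminf_le_of_frequently_le (Frequently.of_forall fun k => ?_)
        rw [lintegral_indicator_one (hmeas _)]
        exact hf (φ k)

variable [NormedAddCommGroup E] [NormedSpace ℝ E] [NormedSpace ℝ F]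

theorem banach_steinhaus_of_measure_lt_norm_le [CompleteSpace E]
    (T : ι → E →L[ℝ] Lp F p Q) {ε : ℝ≥0∞}
    (hT : ∀ f, ∃ r : ℝ, ∀ i, Q {ω | r < ‖T i f ω‖} ≤ ε) :
    ∃ C : ℝ, ∀ i f, Q {ω | C * ‖f‖ < ‖T i f ω‖} ≤ 2 * ε := by
  let K (k : ℕ) : Set E := {f | ∀ i, Q {ω | (k : ℝ) < ‖T i f ω‖} ≤ ε}
  have hK : ∀ k, IsClosed (K k) := fun k => by
    simp only [K, Set.ofPred_forall]
    exact isClosed_iInter fun i =>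
      (isClosed_setOf_measure_lt_norm_le (k : ℝ) ε).preimage (T i).continuous
  have hcover : ⋃ k, K k = Set.univ := Set.eq_univ_of_forall fun f => by
    obtain ⟨r, hr⟩ := hT f
    obtain ⟨k, hk⟩ := exists_nat_ge r
    exact Set.mem_iUnion.2 ⟨k, fun i => (measure_mono fun ω hω => hk.trans_lt hω).trans (hr i)⟩
  obtain ⟨k, c, hc⟩ := nonempty_interior_of_iUnion_of_closed hK hcover
  obtain ⟨δ, hδ, hball⟩ := Metric.nhds_basis_closedBall.mem_iff.1 (mem_interior_iff_mem_nhds.1 hc)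
  have hsmall : ∀ i f, ‖f‖ ≤ δ → Q {ω | (k + k : ℝ) < ‖T i f ω‖} ≤ 2 * ε := fun i f hf => by
    have hcf : c + f ∈ K k := hball (by simpa using hf)
    have hc' : c ∈ K k := interior_subset hc
    have h := measure_add_lt_norm_sub_le (T i (c + f)) (T i c) k k
    rw [← map_sub, add_sub_cancel_left] at h
    exact h.trans ((add_le_add (hcf i) (hc' i)).trans_eq (two_mul ε).symm)
  refine ⟨δ⁻¹ * (k + k), fun i f => ?_⟩
  rcases eq_or_ne f 0 with rfl | hf
  · have hzero : Q {ω | 0 < ‖(0 : Lp F p Q) ω‖} = 0 :=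
      measure_eq_zero_iff_ae_notMem.2 ((Lp.coeFn_zero F p Q).mono fun ω hω => by
        simp only [Set.mem_ofPred_eq, hω]
        simp)
    simp only [norm_zero, mul_zero, map_zero, hzero, zero_le]
  · have hf' : 0 < ‖f‖ := norm_pos_iff.2 hf
    have h := hsmall i ((δ / ‖f‖) • f) (by
      rw [norm_smul, Real.norm_of_nonneg (by positivity), div_mul_cancel₀ _ hf'.ne'])
    rw [map_smul, ← measure_lt_norm_smul _ (inv_pos.2 (div_pos hδ hf')), smul_smul,
      inv_mul_cancel₀ (by positivity), one_smul] at h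
    rwa [show δ⁻¹ * (k + k) * ‖f‖ = (δ / ‖f‖)⁻¹ * (k + k) by field_simp]

end UniformBoundedness

section TightNormalizedSums

variable {X : Type*} [MeasurableSpace X] {P : Kernel X X} [IsMarkovKernel P] {π : Measure X}
  [IsProbabilityMeasure π]

/-- `normalizedSum · n` as a bounded operator from `L₂(π)` to `L₂` of the stationary path law. -/
def normalizedSumLp (hπ : P.Invariant π) (n : ℕ) : Lp ℝ 2 π →L[ℝ] Lp ℝ 2 (pathLaw P π) :=
  (√n)⁻¹ • ∑ i ∈ Finset.range n,
    (Lp.compMeasurePreservingₗᵢ ℝ _ (measurePreserving_eval_pathLaw hπ i)).toContinuousLinearMap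

theorem normalizedSumLp_toLp_ae_eq (hπ : P.Invariant π) (n : ℕ) {G : X → ℝ} (hG : MemLp G 2 π) :
    normalizedSumLp hπ n hG.toLp =ᵐ[pathLaw P π] normalizedSum G n := by
  let T (i : ℕ) : Lp ℝ 2 (pathLaw P π) :=
    Lp.compMeasurePreserving (fun w : ℕ → X => w i) (measurePreserving_eval_pathLaw hπ i) hG.toLp
  have hT : ∀ i, T i =ᵐ[pathLaw P π] fun w => G (w i) := fun i =>
    (Lp.coeFn_compMeasurePreserving _ _).trans
      ((measurePreserving_eval_pathLaw hπ i).quasiMeasurePreserving.ae_eq_comp hG.coeFn_toLp)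
  have hsum : normalizedSumLp hπ n hG.toLp = (√n)⁻¹ • ∑ i ∈ Finset.range n, T i := by
    rw [normalizedSumLp, smul_apply, sum_apply]
    rfl
  rw [hsum]
  filter_upwards [Lp.coeFn_smul (√n)⁻¹ (∑ i ∈ Finset.range n, T i),
    Lp.coeFn_finsetSum (Finset.range n) T, ae_all_iff.2 hT] with w hsmul hadd hTw
  rw [hsmul, Pi.smul_apply, hadd, Finset.sum_apply, smul_eq_mul, normalizedSum, div_eq_inv_mul,
    Finset.sum_congr rfl fun i _ => hTw i]

/-- The closed subspace of `L₂(π)` of functions with mean zero. -/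
def meanZero (π : Measure X) [IsFiniteMeasure π] : Submodule ℝ (Lp ℝ 2 π) :=
  (ℝ ∙ indicatorConstLp 2 MeasurableSet.univ (measure_ne_top π _) (1 : ℝ))ᗮ

theorem mem_meanZero_iff {f : Lp ℝ 2 π} : f ∈ meanZero π ↔ ∫ x, f x ∂π = 0 := by
  rw [meanZero, Submodule.mem_orthogonal_singleton_iff_inner_right, L2.inner_indicatorConstLp_one,
    Measure.restrict_univ]

theorem exists_forall_measure_lt_norm_le_of_isTight {F : Type*} [NormedAddCommGroup F]
    [MeasurableSpace F] {S : Set (Measure F)} (hS : IsTightMeasureSet S) {ε : ℝ≥0∞} (hε : ε ≠ 0) :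
    ∃ r : ℝ, ∀ μ ∈ S, μ {x | r < ‖x‖} ≤ ε := by
  obtain ⟨r, hr⟩ := ((tendsto_measure_norm_gt_of_isTightMeasureSet hS).eventually_lt_const
    (pos_iff_ne_zero.2 hε)).exists
  exact ⟨r, fun μ hμ => (le_iSup₂ (f := fun (μ : Measure F) _ => μ {x | r < ‖x‖}) μ hμ).trans hr.le⟩

theorem map_normalizedSum_eq_map_normalizedSumLp (hπ : P.Invariant π) (n : ℕ) (f : Lp ℝ 2 π) :
    (pathLaw P π).map (normalizedSum f n) = (pathLaw P π).map (normalizedSumLp hπ n f) := by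
  refine Measure.map_congr ((normalizedSumLp_toLp_ae_eq hπ n (Lp.memLp f)).symm.trans ?_)
  rw [Lp.toLp_coeFn]

theorem exists_measure_lt_abs_normalizedSum_le (hπ : P.Invariant π)
    (htight : ∀ G : X → ℝ, MemLp G 2 π → ∫ x, G x ∂π = 0 →
      IsTightMeasureSet {μ | ∃ n : ℕ, 1 ≤ n ∧ μ = (pathLaw P π).map (normalizedSum G n)})
    {ε : ℝ≥0∞} (hε : ε ≠ 0) :
    ∃ C : ℝ, ∀ G : X → ℝ, MemLp G 2 π → ∫ x, G x ∂π = 0 → ∀ n : ℕ, 1 ≤ n →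
      pathLaw P π {w | C * (eLpNorm G 2 π).toReal < |normalizedSum G n w|} ≤ 2 * ε := by
  have : CompleteSpace (meanZero π) := by unfold meanZero; infer_instance
  obtain ⟨C, hC⟩ := banach_steinhaus_of_measure_lt_norm_le (ε := ε) (ι := {n : ℕ // 1 ≤ n})
    (fun n => (normalizedSumLp hπ n).comp (meanZero π).subtypeL) (fun f => by
      obtain ⟨r, hr⟩ := exists_forall_measure_lt_norm_le_of_isTight
        (htight f (Lp.memLp _) (mem_meanZero_iff.1 f.2)) hε
      refine ⟨r, fun n => ?_⟩
      have hrn := hr _ ⟨n, n.2, rfl⟩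
      rwa [map_normalizedSum_eq_map_normalizedSumLp hπ,
        Measure.map_apply (Lp.stronglyMeasurable _).measurable
          (measurableSet_lt measurable_const measurable_norm)] at hrn)
  refine ⟨C, fun G hG hmean n hn => ?_⟩
  have hmem : hG.toLp ∈ meanZero π :=
    mem_meanZero_iff.2 ((integral_congr_ae hG.coeFn_toLp).trans hmean)
  refine (measure_mono_ae ?_).trans (hC ⟨n, hn⟩ ⟨hG.toLp, hmem⟩)
  filter_upwards [normalizedSumLp_toLp_ae_eq hπ n hG] with w hw (hlt : _ < |_|)
  change C * ‖hG.toLp‖ < ‖normalizedSumLp hπ n hG.toLp w‖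
  rwa [Lp.norm_toLp, hw]

end TightNormalizedSums

namespace Renewal

/-- The length, minus one, of a block: a geometric variable with parameter `1 / 2`. -/
def geom : Measure ℕ := geometricMeasure ⟨1 / 2, by norm_num, by norm_num⟩

/-- The law of a fair sign. -/
def coin : Measure Bool := (2⁻¹ : ℝ≥0∞) • (Measure.dirac true + Measure.dirac false)

/-- The law of the length (minus one) and of the sign of a block. -/
def blockLaw : Measure (ℕ × Bool) := geom.prod coin

/-- The state `(j, k, s)` lies `j` steps after the beginning and `k` steps before the end of its
block, which has sign `s`. -/
abbrev State : Type := ℕ × ℕ × Bool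

/-- The law of a state whose age has law `α`, and whose residual length and sign are those of a
fresh block. -/
def aged (α : Measure ℕ) : Measure State := α.prod blockLaw

/-- The law of the successor of a state: the next state of the same block or, at its end, the first
state of a fresh block. -/
def step : State → Measure State
  | (_, 0, _) => aged (Measure.dirac 0)
  | (j, k + 1, s) => Measure.dirac (j + 1, k, s)

/-- The transition kernel of the renewal chain. -/
def chain : Kernel State State := Kernel.ofFunOfCountable step

/-- The invariant probability measure of the renewal chain. -/
def stationary : Measure State := aged geom

instance : IsProbabilityMeasure geom := by unfold geom; infer_instance

instance : IsProbabilityMeasure coin :=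
  ⟨by simp [coin, ← two_mul, ENNReal.mul_inv_cancel]⟩

instance : IsProbabilityMeasure blockLaw := by unfold blockLaw; infer_instance

instance (α : Measure ℕ) [IsProbabilityMeasure α] : IsProbabilityMeasure (aged α) := by
  unfold aged; infer_instance

instance : IsProbabilityMeasure stationary := by unfold stationary; infer_instance

theorem chain_zero (j : ℕ) (s : Bool) : chain (j, 0, s) = aged (Measure.dirac 0) := rfl

theorem chain_succ (j k : ℕ) (s : Bool) : chain (j, k + 1, s) = Measure.dirac (j + 1, k, s) := rfl

instance : IsMarkovKernel chain := by
  refine ⟨?_⟩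
  rintro ⟨j, _ | k, s⟩
  · rw [chain_zero]; infer_instance
  · rw [chain_succ]; infer_instance

theorem geom_singleton (n : ℕ) : geom {n} = 2⁻¹ ^ (n + 1) := by
  rw [geom, geometricMeasure_singleton (by rw [← unitInterval.coe_ne_zero]; norm_num), pow_succ]
  have h : ENNReal.ofReal (1 / 2) = 2⁻¹ := by
    rw [one_div, ENNReal.ofReal_inv_of_pos two_pos, ENNReal.ofReal_ofNat]
  norm_num [ENNReal.ofReal_mul, ENNReal.ofReal_pow, h, pow_succ]

theorem geom_eq : geom = (2⁻¹ : ℝ≥0∞) • (Measure.dirac 0 + geom.map Nat.succ) := by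
  refine Measure.ext_of_singleton fun n => ?_
  rw [Measure.smul_apply, Measure.add_apply, Measure.map_apply .of_discrete .of_discrete,
    geom_singleton, smul_eq_mul]
  rcases n with _ | n
  · have : Nat.succ ⁻¹' {0} = ∅ := by ext; simp
    simp [this]
  · have : Nat.succ ⁻¹' {n + 1} = {n} := by ext; simp
    rw [this, geom_singleton]
    simp [pow_succ']

theorem lintegral_geom (f : ℕ → ℝ≥0∞) :
    ∫⁻ k, f k ∂geom = 2⁻¹ * (f 0 + ∫⁻ k, f (k + 1) ∂geom) := by
  conv_lhs => rw [geom_eq]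
  rw [lintegral_smul_measure, lintegral_add_measure, lintegral_dirac,
    lintegral_map .of_discrete .of_discrete, smul_eq_mul]

theorem lintegral_aged (α : Measure ℕ) [SFinite α] (f : State → ℝ≥0∞) :
    ∫⁻ x, f x ∂aged α = ∫⁻ j, ∫⁻ k, ∫⁻ s, f (j, k, s) ∂coin ∂geom ∂α := by
  rw [aged, lintegral_prod _ Measurable.of_discrete.aemeasurable]
  simp_rw [blockLaw, lintegral_prod _ Measurable.of_discrete.aemeasurable]

theorem aged_smul_add (c : ℝ≥0∞) (α β : Measure ℕ) [SFinite α] [SFinite β] :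
    aged (c • (α + β)) = c • (aged α + aged β) := by
  simp only [aged, Measure.prod_smul_left, Measure.add_prod]

/-- The residual length of a block is memoryless. -/
theorem chain_comp_aged (α : Measure ℕ) [IsProbabilityMeasure α] :
    chain ∘ₘ aged α = (2⁻¹ : ℝ≥0∞) • (aged (Measure.dirac 0) + aged (α.map Nat.succ)) := by
  have : IsProbabilityMeasure (α.map Nat.succ) :=
    Measure.isProbabilityMeasure_map Measurable.of_discrete.aemeasurable
  ext A hA
  have hsucc : aged (α.map Nat.succ) A
      = ∫⁻ j, ∫⁻ k, ∫⁻ s, A.indicator 1 (j + 1, k, s) ∂coin ∂geom ∂α := by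
    rw [← lintegral_indicator_one hA, lintegral_aged, lintegral_map .of_discrete .of_discrete]
  rw [Measure.bind_apply hA chain.aemeasurable, lintegral_aged, Measure.smul_apply,
    Measure.add_apply, hsucc]
  simp_rw [lintegral_geom fun k => ∫⁻ s, chain (_, k, s) A ∂coin, chain_zero, chain_succ,
    Measure.dirac_apply' _ hA, lintegral_const, measure_univ, mul_one]
  rw [lintegral_const_mul _ .of_discrete, lintegral_add_left measurable_const, lintegral_const,
    measure_univ, mul_one, smul_eq_mul]

theorem chain_invariant : chain.Invariant stationary := by
  change chain ∘ₘ aged geom = aged geom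
  rw [chain_comp_aged, ← aged_smul_add, ← geom_eq]

theorem chain_pow_succ_comp_aged_real (α : Measure ℕ) [IsProbabilityMeasure α] (n : ℕ)
    (A : Set State) :
    ((chain ^ (n + 1)) ∘ₘ aged α).real A
      = (((chain ^ n) ∘ₘ aged (Measure.dirac 0)).real A
        + ((chain ^ n) ∘ₘ aged (α.map Nat.succ)).real A) / 2 := by
  have : IsProbabilityMeasure (α.map Nat.succ) :=
    Measure.isProbabilityMeasure_map Measurable.of_discrete.aemeasurable
  have h : (chain ^ (n + 1)) ∘ₘ aged α = (chain ^ n) ∘ₘ (chain ∘ₘ aged α) := by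
    rw [pow_succ]; exact Measure.comp_assoc.symm
  rw [h, chain_comp_aged, Measure.comp_smul, Measure.comp_add, measureReal_ennreal_smul_apply,
    measureReal_add_apply, ENNReal.toReal_inv, ENNReal.toReal_ofNat, inv_mul_eq_div]

theorem abs_chain_pow_comp_aged_sub_le (n : ℕ) (α β : Measure ℕ) [IsProbabilityMeasure α]
    [IsProbabilityMeasure β] (A : Set State) :
    |((chain ^ n) ∘ₘ aged α).real A - ((chain ^ n) ∘ₘ aged β).real A| ≤ (1 / 2) ^ n := by
  induction n generalizing α β with
  | zero => exact (abs_measureReal_sub_measureReal_le_one A).trans_eq (pow_zero _).symm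
  | succ n ih =>
    have (α : Measure ℕ) [IsProbabilityMeasure α] : IsProbabilityMeasure (α.map Nat.succ) :=
      Measure.isProbabilityMeasure_map Measurable.of_discrete.aemeasurable
    rw [chain_pow_succ_comp_aged_real, chain_pow_succ_comp_aged_real, ← sub_div,
      add_sub_add_left_eq_sub, abs_div, abs_two, pow_succ, mul_one_div]
    gcongr
    exact ih _ _

theorem abs_chain_pow_real_sub_stationary_le (x : State) (n : ℕ) (A : Set State) :
    |((chain ^ n) x).real A - stationary.real A| ≤ 2 ^ (x.2.1 + 1) * (1 / 2) ^ n := by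
  have hfresh (n : ℕ) : |((chain ^ n) ∘ₘ aged (Measure.dirac 0)).real A - stationary.real A|
      ≤ (1 / 2) ^ n := by
    have h := abs_chain_pow_comp_aged_sub_le n (Measure.dirac 0) geom A
    rwa [← stationary, (invariant_pow chain_invariant n).def] at h
  have hsucc (n : ℕ) (x : State) : (chain ^ (n + 1)) x = (chain ^ n) ∘ₘ chain x := by
    rw [pow_succ]; exact Kernel.comp_apply _ _ _
  obtain ⟨j, k, s⟩ := x
  induction n generalizing j k s with
  | zero =>
    rw [pow_zero (1 / 2 : ℝ), mul_one]
    exact (abs_measureReal_sub_measureReal_le_one A).trans (one_le_pow₀ one_le_two)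
  | succ n ih =>
    rw [hsucc]
    rcases k with _ | k
    · rw [chain_zero]
      exact (hfresh n).trans_eq (by dsimp only; ring)
    · rw [chain_succ, Measure.dirac_bind (chain ^ n).measurable]
      exact (ih (j + 1) k s).trans_eq (by dsimp only; ring)

theorem chain_isGeometricallyErgodic : IsGeometricallyErgodic chain stationary :=
  isGeometricallyErgodic_of_abs_sub_le chain_invariant (by norm_num) (by norm_num)
    (fun x : State => one_le_pow₀ one_le_two)
    fun x n A _ => abs_chain_pow_real_sub_stationary_le x n A

theorem chain_isPsiIrreducibleAperiodic : IsPsiIrreducibleAperiodic chain := by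
  refine isPsiIrreducibleAperiodic_of_tendsto chain_invariant fun x A _ => ?_
  refine tendsto_iff_norm_sub_tendsto_zero.2
    (squeeze_zero_norm' (.of_forall fun n => ?_) (?_ : Tendsto
      (fun n : ℕ => 2 ^ (x.2.1 + 1) * (1 / 2 : ℝ) ^ n) atTop (𝓝 0)))
  · rw [norm_norm]
    exact abs_chain_pow_real_sub_stationary_le x n A
  · simpa using (tendsto_pow_atTop_nhds_zero_of_lt_one (by norm_num : (0 : ℝ) ≤ 1 / 2)
      (by norm_num)).const_mul (2 ^ (x.2.1 + 1))

/-- The states of age `j` and residual length `k`. -/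
def cell (j k : ℕ) : Set State := {j} ×ˢ ({k} ×ˢ Set.univ)

/-- The states that lie in a block of length `m + 1`. -/
def block (m : ℕ) : Set State := {x | x.1 + x.2.1 = m}

theorem cell_subset_block {j k m : ℕ} (h : j + k = m) : cell j k ⊆ block m := by
  rintro x ⟨rfl, rfl, -⟩
  exact h

theorem aged_cell (α : Measure ℕ) (j k : ℕ) : aged α (cell j k) = α {j} * 2⁻¹ ^ (k + 1) := by
  rw [aged, blockLaw, cell, Measure.prod_prod, Measure.prod_prod, measure_univ, mul_one,
    geom_singleton]

theorem stationary_real_cell (j k : ℕ) : stationary.real (cell j k) = (1 / 2) ^ (j + k + 2) := by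
  rw [measureReal_def, stationary, aged_cell, geom_singleton, ← pow_add, ENNReal.toReal_pow,
    ENNReal.toReal_inv, ENNReal.toReal_ofNat, ← one_div]
  congr 1
  omega

theorem chain_cell_zero_le (x : State) (m : ℕ) : chain x (cell 0 m) ≤ 2⁻¹ ^ (m + 1) := by
  obtain ⟨j, _ | k, s⟩ := x
  · rw [chain_zero, aged_cell, Measure.dirac_apply' _ .of_discrete,
      Set.indicator_of_mem (Set.mem_singleton 0), Pi.one_apply, one_mul]
  · simp [chain_succ, cell]

open Finset.HasAntidiagonal in
theorem stationary_real_block (m : ℕ) :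
    stationary.real (block m) = (m + 1) * (1 / 2) ^ (m + 2) := by
  have hunion : block m = ⋃ p ∈ antidiagonal m, cell p.1 p.2 := by
    ext ⟨j, k, s⟩
    simp [block, cell, eq_comm]
  have hdisj : ((antidiagonal m : Finset (ℕ × ℕ)) : Set (ℕ × ℕ)).PairwiseDisjoint
      fun p => cell p.1 p.2 := fun p _ q _ hpq => Set.disjoint_left.2 fun x hp hq =>
    hpq (Prod.ext (hp.1.symm.trans hq.1) (hp.2.1.symm.trans hq.2.1))
  rw [hunion, measureReal_biUnion_finset hdisj fun _ _ => .of_discrete]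
  have hcell : ∀ p ∈ antidiagonal m, stationary.real (cell p.1 p.2) = (1 / 2) ^ (m + 2) :=
    fun p hp => by rw [stationary_real_cell, mem_antidiagonal.1 hp]
  rw [Finset.sum_congr rfl hcell, Finset.sum_const, Finset.Nat.card_antidiagonal, nsmul_eq_mul,
    Nat.cast_succ]

/-- The sign of a Boolean: `1` for `true`, `-1` for `false`. -/
def sign (s : Bool) : ℝ := if s then 1 else -1

/-- The indicator function of the blocks of length `m + 1`, multiplied by the sign of the block. -/
def signedBlock (m : ℕ) : State → ℝ := (block m).indicator fun x => sign x.2.2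

/-- The function `z ^ j` of the age `j` on the blocks of length `m + 1`, multiplied by the sign of
the block. -/
def wave (z : ℂ) (m : ℕ) (x : State) : ℂ := z ^ x.1 * signedBlock m x

theorem abs_sign (s : Bool) : |sign s| = 1 := by
  cases s <;> simp [sign]

theorem abs_signedBlock (m : ℕ) (x : State) : |signedBlock m x| = (block m).indicator 1 x := by
  rw [signedBlock, ← Real.norm_eq_abs, norm_indicator_eq_indicator_norm]
  simp only [Real.norm_eq_abs, abs_sign]
  rfl

theorem norm_wave {z : ℂ} (hz : ‖z‖ = 1) (m : ℕ) (x : State) :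
    ‖wave z m x‖ = (block m).indicator 1 x := by
  rw [wave, norm_mul, norm_pow, hz, one_pow, one_mul, Complex.norm_real, Real.norm_eq_abs,
    abs_signedBlock]

theorem memLp_signedBlock (m : ℕ) : MemLp (signedBlock m) 2 stationary :=
  memLp_of_norm_eq_indicator Measurable.of_discrete.aestronglyMeasurable (abs_signedBlock m)

theorem memLp_wave {z : ℂ} (hz : ‖z‖ = 1) (m : ℕ) : MemLp (wave z m) 2 stationary :=
  memLp_of_norm_eq_indicator Measurable.of_discrete.aestronglyMeasurable (norm_wave hz m)

theorem sign_not (s : Bool) : sign (!s) = -sign s := by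
  cases s <;> simp [sign]

/-- The state with the same age and residual length, in a block of the opposite sign. -/
def flip : State → State := Prod.map id (Prod.map id not)

theorem measurePreserving_flip (α : Measure ℕ) [IsProbabilityMeasure α] :
    MeasurePreserving flip (aged α) (aged α) := by
  have hcoin : MeasurePreserving not coin coin := by
    refine ⟨.of_discrete, ?_⟩
    rw [coin, Measure.map_smul, Measure.map_add _ _ .of_discrete, Measure.map_dirac,
      Measure.map_dirac, add_comm]
    rfl
  exact (MeasurePreserving.id α).prod ((MeasurePreserving.id geom).prod hcoin)

theorem signedBlock_flip (m : ℕ) (x : State) : signedBlock m (flip x) = -signedBlock m x := by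
  by_cases h : x.1 + x.2.1 = m <;> simp [signedBlock, block, flip, h, sign_not]

theorem integral_aged_eq_zero {E : Type*} [NormedAddCommGroup E] [NormedSpace ℝ E] (α : Measure ℕ)
    [IsProbabilityMeasure α] {f : State → E} (hf : ∀ x, f (flip x) = -f x) :
    ∫ x, f x ∂aged α = 0 := by
  have h : ∫ x, f x ∂aged α = ∫ x, f (flip x) ∂aged α := by
    conv_lhs => rw [← (measurePreserving_flip α).map_eq]
    exact integral_map Measurable.of_discrete.aemeasurable
      (StronglyMeasurable.of_discrete).aestronglyMeasurable
  simp_rw [hf, integral_neg] at h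
  have : IsAddTorsionFree E := .of_isTorsionFree ℝ E
  exact self_eq_neg.1 h

theorem integral_aged_wave (α : Measure ℕ) [IsProbabilityMeasure α] (z : ℂ) (m : ℕ) :
    ∫ x, wave z m x ∂aged α = 0 :=
  integral_aged_eq_zero α fun x => by
    rw [wave, signedBlock_flip, Complex.ofReal_neg, mul_neg]
    rfl

theorem integral_signedBlock (m : ℕ) : ∫ x, signedBlock m x ∂stationary = 0 :=
  integral_aged_eq_zero geom (signedBlock_flip m)

theorem smul_wave_sub_integral_wave (z : ℂ) (m : ℕ) (x : State) :
    z * wave z m x - ∫ y, wave z m y ∂chain x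
      = (cell m 0).indicator (fun x => z * wave z m x) x := by
  obtain ⟨j, _ | k, s⟩ := x
  · rw [chain_zero, integral_aged_wave, sub_zero]
    by_cases h : j = m <;> simp [cell, wave, signedBlock, block, h]
  · have hage : wave z m (j + 1, k, s) = z * wave z m (j, k + 1, s) := by
      simp only [wave, signedBlock, block, Set.indicator_apply, Set.mem_ofPred_eq,
        add_right_comm j 1, add_assoc j, pow_succ']
      ring_nf
    rw [chain_succ, integral_dirac, hage, sub_self]
    simp [cell]

theorem sphere_subset_spectrum_l2Operator :
    Metric.sphere (0 : ℂ) 1 ⊆ spectrum ℂ (l2Operator chain stationary chain_invariant) := by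
  intro z hz
  replace hz : ‖z‖ = 1 := mem_sphere_zero_iff_norm.1 hz
  refine mem_spectrum_l2Operator chain_invariant fun C => ?_
  obtain ⟨m, hm⟩ := exists_nat_gt (C ^ 2)
  refine ⟨wave z m, memLp_wave hz m, ?_⟩
  have hdefect : ∀ x, ‖z * wave z m x - ∫ y, wave z m y ∂chain x‖ = (cell m 0).indicator 1 x :=
    fun x => by
      rw [smul_wave_sub_integral_wave]
      by_cases hx : x ∈ cell m 0
      · rw [Set.indicator_of_mem hx, norm_mul, hz, norm_wave hz, one_mul,
          Set.indicator_of_mem (cell_subset_block m.add_zero hx), Set.indicator_of_mem hx]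
      · rw [Set.indicator_of_notMem hx, Set.indicator_of_notMem hx, norm_zero]
  rw [toReal_eLpNorm_two_of_norm_eq_indicator .of_discrete hdefect,
    toReal_eLpNorm_two_of_norm_eq_indicator .of_discrete (norm_wave hz m), stationary_real_cell,
    stationary_real_block, add_zero, Real.sqrt_mul (by positivity)]
  gcongr
  exact Real.lt_sqrt_of_sq_lt (by linarith)

theorem not_hasSpectralGap :
    ¬ HasSpectralGap (l2Operator chain stationary chain_invariant) :=
  not_hasSpectralGap_of_sphere_subset_spectrum sphere_subset_spectrum_l2Operator

/-- The transitions that the renewal chain can make: to the next state of the same block or, at its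
end, to the first state of some block. -/
def IsStep : State → State → Prop
  | (_, 0, _), y => y.1 = 0
  | (j, k + 1, s), y => y = (j + 1, k, s)

theorem ae_isStep (x : State) : ∀ᵐ y ∂chain x, IsStep x y := by
  obtain ⟨j, _ | k, s⟩ := x
  · have hdirac : ∀ᵐ i ∂Measure.dirac 0, i = 0 := by simp [ae_dirac_eq]
    rw [chain_zero, aged]
    exact Measure.quasiMeasurePreserving_fst.ae hdirac
  · rw [chain_succ, ae_dirac_eq]
    rfl

theorem signedBlock_eq_of_isStep (m : ℕ) {x y : State} (h : IsStep x y) :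
    signedBlock m y = x.2.1 * signedBlock m x - y.2.1 * signedBlock m y
      + (m + 1) * (cell 0 m).indicator (signedBlock m) y := by
  obtain ⟨j, _ | k, s⟩ := x
  · obtain ⟨_, k', s'⟩ := y
    obtain rfl : _ = 0 := h
    by_cases hk : k' = m
    · have hcell : (0, k', s') ∈ cell 0 m := ⟨rfl, hk, trivial⟩
      rw [Set.indicator_of_mem hcell, hk]
      push_cast
      ring
    · simp [cell, signedBlock, block, hk]
  · obtain rfl : y = (j + 1, k, s) := h
    have hage : signedBlock m (j + 1, k, s) = signedBlock m (j, k + 1, s) := by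
      simp only [signedBlock, block, Set.indicator_apply, Set.mem_ofPred_eq,
        add_right_comm j 1, add_assoc j]
    have hcell : (j + 1, k, s) ∉ cell 0 m := fun hmem => j.succ_ne_zero hmem.1
    rw [hage, Set.indicator_of_notMem hcell]
    push_cast
    ring

theorem sum_Ico_signedBlock (m : ℕ) {w : ℕ → State} (hw : ∀ i, IsStep (w i) (w (i + 1))) (n : ℕ) :
    ∑ i ∈ Finset.Ico 1 (n + 1), signedBlock m (w i)
      = (w 0).2.1 * signedBlock m (w 0) - (w n).2.1 * signedBlock m (w n)
        + (m + 1) * ∑ i ∈ Finset.Ico 1 (n + 1), (cell 0 m).indicator (signedBlock m) (w i) := by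
  simp only [Finset.sum_Ico_eq_sum_range, add_tsub_cancel_right, add_comm 1]
  rw [Finset.sum_congr rfl fun i _ => signedBlock_eq_of_isStep m (hw i), Finset.sum_add_distrib,
    Finset.sum_range_sub', ← Finset.mul_sum]

theorem abs_sum_signedBlock_of_existsUnique {m n : ℕ} {w : ℕ → State}
    (hw : ∀ i, IsStep (w i) (w (i + 1))) (h₀ : w 0 ∉ block m) (hn : w n ∉ block m)
    (huniq : ∃! i, i ∈ Finset.Ico 1 (n + 1) ∧ w i ∈ cell 0 m) :
    |∑ i ∈ Finset.range (n + 1), signedBlock m (w i)| = m + 1 := by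
  obtain ⟨i, ⟨hi, hwi⟩, hunique⟩ := huniq
  have hstart : ∑ i ∈ Finset.Ico 1 (n + 1), (cell 0 m).indicator (signedBlock m) (w i)
      = signedBlock m (w i) := by
    rw [Finset.sum_eq_single_of_mem i hi fun j hj hji =>
      Set.indicator_of_notMem (fun hwj => hji (hunique j ⟨hj, hwj⟩)) _, Set.indicator_of_mem hwi]
  have hzero : ∀ {x}, x ∉ block m → signedBlock m x = 0 := fun hx => Set.indicator_of_notMem hx _
  have hblock : w i ∈ block m := cell_subset_block m.zero_add hwi
  rw [Finset.range_eq_Ico, Finset.sum_eq_sum_Ico_succ_bot n.succ_pos, sum_Ico_signedBlock m hw,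
    hstart, hzero h₀, hzero hn, mul_zero, mul_zero, sub_zero, zero_add, zero_add, abs_mul,
    abs_signedBlock, Set.indicator_of_mem hblock, Pi.one_apply, mul_one,
    abs_of_nonneg (by positivity)]

theorem pathLaw_real_cell_zero_inter_le (m : ℕ) {i j : ℕ} (hij : i ≠ j) :
    (pathLaw chain stationary).real ({w | w i ∈ cell 0 m} ∩ {w | w j ∈ cell 0 m})
      ≤ (1 / 2) ^ (m + 1) * (1 / 2) ^ (m + 2) := by
  wlog h : i < j generalizing i j
  · rw [Set.inter_comm]
    exact this hij.symm (hij.symm.lt_of_le (not_lt.1 h))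
  have hpair := pathLaw_pair_le chain_invariant (.of_discrete (s := cell 0 m))
    (.of_discrete (s := cell 0 m)) (fun x => chain_cell_zero_le x m) h
  have hreal := ENNReal.toReal_mono (by finiteness) hpair
  rw [ENNReal.toReal_mul, ← measureReal_def, ← measureReal_def, stationary_real_cell,
    zero_add] at hreal
  exact hreal.trans_eq (by simp)

/-- The expected number of blocks of length `m + 1` that begin at a time in `{1, …, 2 ^ m}` is
`1 / 4`, and the expected number of ordered pairs of such blocks is at most `1 / 8`. -/
theorem one_div_eight_le_pathLaw_existsUnique (m : ℕ) :
    1 / 8 ≤ (pathLaw chain stationary).real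
      {w | ∃! i, i ∈ Finset.Ico 1 (2 ^ m + 1) ∧ w i ∈ cell 0 m} := by
  have hpow : (2 : ℝ) ^ m * (1 / 2) ^ m = 1 := by rw [← mul_pow]; norm_num
  have hmeas (i : ℕ) : MeasurableSet {w : ℕ → State | w i ∈ cell 0 m} :=
    measurable_pi_apply i .of_discrete
  have hpairs (i : ℕ) (hi : i ∈ Finset.Ico 1 (2 ^ m + 1)) :
      ∑ j ∈ (Finset.Ico 1 (2 ^ m + 1)).erase i,
        (pathLaw chain stationary).real ({w | w i ∈ cell 0 m} ∩ {w | w j ∈ cell 0 m})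
      ≤ (1 / 2) ^ (m + 3) := by
    refine (Finset.sum_le_card_nsmul _ _ _ fun j hj =>
      pathLaw_real_cell_zero_inter_le m (Finset.ne_of_mem_erase hj).symm).trans ?_
    rw [Finset.card_erase_of_mem hi, Nat.card_Ico, add_tsub_cancel_right, nsmul_eq_mul]
    calc ((2 ^ m - 1 : ℕ) : ℝ) * ((1 / 2) ^ (m + 1) * (1 / 2) ^ (m + 2))
        ≤ 2 ^ m * ((1 / 2) ^ (m + 1) * (1 / 2) ^ (m + 2)) := by
          gcongr
          exact_mod_cast Nat.sub_le _ _
      _ = (1 / 2) ^ (m + 3) := by linear_combination (1 / 2) ^ (m + 3) * hpow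
  calc (1 / 8 : ℝ)
      = ∑ i ∈ Finset.Ico 1 (2 ^ m + 1), ((1 / 2) ^ (m + 2) - (1 / 2) ^ (m + 3)) := by
        rw [Finset.sum_const, Nat.card_Ico, add_tsub_cancel_right, nsmul_eq_mul]
        push_cast
        linear_combination -1 / 8 * hpow
    _ ≤ _ := Finset.sum_le_sum fun i hi => by
        rw [pathLaw_real_eval chain_invariant i .of_discrete, stationary_real_cell, zero_add]
        exact sub_le_sub_left (hpairs i hi) _
    _ ≤ _ := sum_sub_sum_inter_le_measureReal_existsUnique _ hmeas

theorem stationary_real_block_lt {m : ℕ} (hm : 6 ≤ m) : stationary.real (block m) < 1 / 32 := by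
  rw [stationary_real_block]
  induction m, hm using Nat.le_induction with
  | base => norm_num
  | succ m _ ih =>
    have hpos : (0 : ℝ) ≤ m * (1 / 2) ^ (m + 2) := by positivity
    rw [Nat.cast_succ, add_right_comm m 1, pow_succ]
    linarith

theorem one_div_sixteen_lt_pathLaw_abs_sum_signedBlock {m : ℕ} (hm : 6 ≤ m) :
    1 / 16 < (pathLaw chain stationary).real
      {w | |∑ i ∈ Finset.range (2 ^ m + 1), signedBlock m (w i)| = m + 1} := by
  set U : Set (ℕ → State) := {w | ∃! i, i ∈ Finset.Ico 1 (2 ^ m + 1) ∧ w i ∈ cell 0 m}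
  set S : Set (ℕ → State) := {w | |∑ i ∈ Finset.range (2 ^ m + 1), signedBlock m (w i)| = m + 1}
  have hUS : U ≤ᵐ[pathLaw chain stationary]
      (S ∪ {w | w 0 ∈ block m} ∪ {w | w (2 ^ m) ∈ block m} : Set (ℕ → State)) := by
    filter_upwards [ae_pathLaw_step (π := stationary) .of_discrete ae_isStep] with w hw hU
    by_cases h₀ : w 0 ∈ block m
    · exact .inl (.inr h₀)
    by_cases hn : w (2 ^ m) ∈ block m
    · exact .inr hn
    exact .inl (.inl (abs_sum_signedBlock_of_existsUnique hw h₀ hn hU))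
  have hunion := ENNReal.toReal_mono (measure_ne_top _ _) (measure_mono_ae hUS)
  have hle := hunion.trans ((measureReal_union_le _ _).trans
    (add_le_add_left (measureReal_union_le _ _) _))
  rw [pathLaw_real_eval chain_invariant 0 .of_discrete,
    pathLaw_real_eval chain_invariant (2 ^ m) .of_discrete] at hle
  have hblock := stationary_real_block_lt hm
  have hU := one_div_eight_le_pathLaw_existsUnique m
  rw [measureReal_def] at hU
  linarith

theorem mul_eLpNorm_signedBlock_lt {C : ℝ} {m : ℕ} (hm : C ^ 2 < m + 1) :
    C * (eLpNorm (signedBlock m) 2 stationary).toReal < (m + 1) / √(2 ^ m + 1 : ℕ) := by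
  rw [toReal_eLpNorm_two_of_norm_eq_indicator .of_discrete (abs_signedBlock m),
    stationary_real_block]
  have hpow : (m + 1) * (1 / 2 : ℝ) ^ (m + 2) ≤ (m + 1) / (2 ^ m + 1 : ℕ) := by
    rw [one_div, inv_pow, ← div_eq_mul_inv]
    gcongr
    push_cast
    linarith [one_le_pow₀ (M₀ := ℝ) one_le_two (n := m), pow_add (2 : ℝ) m 2]
  calc C * √((m + 1) * (1 / 2) ^ (m + 2))
      ≤ |C| * √((m + 1) / (2 ^ m + 1 : ℕ)) := by
        gcongr
        exact le_abs_self C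
    _ < √(m + 1) * √((m + 1) / (2 ^ m + 1 : ℕ)) := by
        gcongr
        exact Real.lt_sqrt_of_sq_lt (by rwa [sq_abs])
    _ = (m + 1) / √(2 ^ m + 1 : ℕ) := by
        rw [Real.sqrt_div (by positivity), ← mul_div_assoc, Real.mul_self_sqrt (by positivity)]

theorem exists_not_isTightMeasureSet_normalizedSum :
    ∃ G : State → ℝ, MemLp G 2 stationary ∧ ∫ x, G x ∂stationary = 0 ∧
      ¬ IsTightMeasureSet {μ : Measure ℝ | ∃ n : ℕ, 1 ≤ n ∧
        μ = (pathLaw chain stationary).map (normalizedSum G n)} := by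
  by_contra! htight
  have hε : (1 / 32 : ℝ≥0∞) ≠ 0 := by simp
  obtain ⟨C, hC⟩ := exists_measure_lt_abs_normalizedSum_le chain_invariant htight hε
  obtain ⟨m, hm⟩ := exists_nat_gt (max 6 (C ^ 2))
  have hm6 : 6 ≤ m := by exact_mod_cast (le_max_left _ _).trans hm.le
  have hmC : C ^ 2 < m + 1 := ((le_max_right _ _).trans_lt hm).trans (lt_add_one _)
  have hle := hC (signedBlock m) (memLp_signedBlock m) (integral_signedBlock m) (2 ^ m + 1)
    (Nat.le_add_left _ _)
  have hreal := ENNReal.toReal_mono (by finiteness) hle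
  refine (one_div_sixteen_lt_pathLaw_abs_sum_signedBlock hm6).not_ge
    ((measureReal_mono fun w hw => ?_).trans (hreal.trans_eq (by norm_num)))
  rw [Set.mem_ofPred_eq] at hw ⊢
  rw [normalizedSum, abs_div, hw, abs_of_nonneg (Real.sqrt_nonneg _)]
  exact mul_eLpNorm_signedBlock_lt hmC

end Renewal

end MarkovGap

end

theorem theorem2 :
    ∃ (X : Type) (_ : Countable X) (_ : MeasurableSpace X) (_ : DiscreteMeasurableSpace X)
      (P : Kernel X X) (_ : IsMarkovKernel P)
      (π : Measure X) (_ : IsProbabilityMeasure π) (hπ : P.Invariant π),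
      MarkovGap.IsPsiIrreducibleAperiodic P ∧
      MarkovGap.IsGeometricallyErgodic P π ∧
      ¬ MarkovGap.HasSpectralGap (MarkovGap.l2Operator P π hπ) ∧
      ∃ G : X → ℝ, MemLp G 2 π ∧ ∫ x, G x ∂π = 0 ∧
        ¬ IsTightMeasureSet {μ : Measure ℝ | ∃ n : ℕ, 1 ≤ n ∧
          μ = (MarkovGap.pathLaw P π).map (MarkovGap.normalizedSum G n)} :=
  ⟨MarkovGap.Renewal.State, inferInstance, inferInstance, inferInstance,
    MarkovGap.Renewal.chain, inferInstance, MarkovGap.Renewal.stationary, inferInstance,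
    MarkovGap.Renewal.chain_invariant, MarkovGap.Renewal.chain_isPsiIrreducibleAperiodic,
    MarkovGap.Renewal.chain_isGeometricallyErgodic, MarkovGap.Renewal.not_hasSpectralGap,
    MarkovGap.Renewal.exists_not_isTightMeasureSet_normalizedSum⟩
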